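/- Let $K$ be an algebraically closed field of characteristic zero, let $T=(K^\times)^r$ be a torus, and let $V$ be an $n$-dimensional representation of $T$ with weights $s_1,\dots,s_n\in X^*(T)\cong\mathbb Z^r$; that is, $V$ has a basis $b_1,\dots,b_n$ such that $t\cdot b_i=\Big(\prod_{j=1}^r t_j^{s_i^j}\Big)b_i$ for all $t\in T$ and all $i$. A vector $x\in V$ is called nilpotent if $0$ lies in the Zariski closure of $T.x$, and $(T,V)$ is called visible if there are only finitely many $T$-orbits of nilpotent vectors. Regard the weights as elements of the $\mathbb Q$-vector space $X^*(T)\otimes_{\mathbb Z}\mathbb Q\cong\mathbb Q^r$, and write $\langle A\rangle$ for the $\mathbb Q$-linear span of a subset $A$ of it. Then $(T,V)$ is visible if and only if there are an integer $l\ge 0$ and a decomposition $\{1,\dots,n\}=I_0\sqcup I_1\sqcup\dots\sqcup I_l$ into pairwise disjoint subsets ($I_0$ may be empty) such that (i) $\langle s_i\mid 1\le i\le n\rangle=\bigoplus_{j=0}^l\langle s_i\mid i\in I_j\rangle$; (ii) $\dim\langle s_i\mid i\in I_0\rangle=\# I_0$, and $\dim\langle s_i\mid i\in I_j\rangle=\#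 I_j-1$ for every $j\ge 1$; (iii) for every $j\ge 1$, $0$ belongs to the interior, for the classical topology, of the convex hull of $\{s_i\mid i\in I_j\}$ in the linear span $\langle s_i\mid i\in I_j\rangle$. -/

import Mathlib

/-- The torus `(Kˣ)^r`. -/
abbrev Torus (K : Type*) [Field K] (r : ℕ) : Type _ := Fin r → Kˣ

/-- The character `t ↦ ∏ j, t_j ^ a_j` of the torus `(Kˣ)^r` attached to `a ∈ ℤ^r`; this is the
usual identification `X^*(T) ≅ ℤ^r`. -/
def Torus.character {K : Type*} [Field K] {r : ℕ} (a : Fin r → ℤ) : Torus K r →* Kˣ where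
  toFun t := ∏ j, t j ^ a j
  map_one' := by simp
  map_mul' t u := by simp [mul_zpow, Finset.prod_mul_distrib]

section Zariski

/-- The algebra of polynomial functions on the vector space `V`: the subalgebra of all functions
`V → K` generated by the linear forms. -/
def polynomialFunctionAlgebra (K V : Type*) [Field K] [AddCommGroup V] [Module K V] :
    Subalgebra K (V → K) :=
  Algebra.adjoin K (Set.range fun f : Module.Dual K V => (f : V → K))

/-- Zariski closed subsets of `V`: common zero sets of families of polynomial functions. -/
def IsZariskiClosed (K : Type*) {V : Type*} [Field K] [AddCommGroup V] [Module K V]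
    (Z : Set V) : Prop :=
  ∃ F : Set (V → K), F ⊆ polynomialFunctionAlgebra K V ∧ Z = {v | ∀ p ∈ F, p v = 0}

/-- The Zariski closure of a subset of `V`. -/
def zariskiClosure (K : Type*) {V : Type*} [Field K] [AddCommGroup V] [Module K V]
    (S : Set V) : Set V :=
  ⋂₀ {Z | IsZariskiClosed K Z ∧ S ⊆ Z}

end Zariski

namespace Representation

variable {K G V : Type*} [Field K] [Group G] [AddCommGroup V] [Module K V]

/-- The orbit `G.x`. -/
def orbitOf (ρ : Representation K G V) (x : V) : Set V := Set.range fun g => ρ g x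

/-- `x` is nilpotent if `0` lies in the Zariski closure of its orbit. -/
def IsNilpotentVector (ρ : Representation K G V) (x : V) : Prop :=
  (0 : V) ∈ zariskiClosure K (ρ.orbitOf x)

/-- A representation is visible if it has finitely many nilpotent orbits. -/
def IsVisible (ρ : Representation K G V) : Prop :=
  {O : Set V | ∃ x : V, ρ.IsNilpotentVector x ∧ O = ρ.orbitOf x}.Finite

end Representation

/-- `T = (Kˣ)^r` acts on `V = ⨁ᵢ K bᵢ` with weights `s 0, …, s (n-1)`: the basis vector `b i` is
a weight vector of weight `s i`. -/
def IsWeightBasis {K V : Type*} [Field K] [AddCommGroup V] [Module K V] {r n : ℕ}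
    (ρ : Representation K (Torus K r) V) (s : Fin n → Fin r → ℤ)
    (b : Module.Basis (Fin n) K V) : Prop :=
  ∀ (t : Torus K r) (i : Fin n), ρ t (b i) = (Torus.character (s i) t : K) • b i

/-- The image in `W_ℚ = X^*(T) ⊗ ℚ ≅ ℚ^r` of the character `a ∈ X^*(T) ≅ ℤ^r`. -/
def rationalWeight {r : ℕ} (a : Fin r → ℤ) : Fin r → ℚ := fun j => (a j : ℚ)

/-- The set `{s i | i ∈ I}` of weights with index in `I`, as a subset of `ℚ^r`. -/
def weightSet {r n : ℕ} (s : Fin n → Fin r → ℤ) (I : Finset (Fin n)) : Set (Fin r → ℚ) :=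
  (fun i => rationalWeight (s i)) '' (I : Set (Fin n))

/-- The interior, for the classical topology, of the convex hull of `A` inside the linear span
`⟨A⟩`. -/
def convexHullInterior {r : ℕ} (A : Set (Fin r → ℚ)) : Set (Fin r → ℚ) :=
  (fun w : Submodule.span ℚ A => (w : Fin r → ℚ)) ''
    interior {w : Submodule.span ℚ A | (w : Fin r → ℚ) ∈ convexHull ℚ A}

/-!
Put `R = {d ∈ ℚⁿ | ∑ dᵢ sᵢ = 0}`. A monomial whose exponent lies in `R` is constant on orbits, and
by independence of characters these monomials decide whether `0` is in the closure of `T.x`: `x`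
is nilpotent if and only if no nonzero `p ∈ R` with `0 ≤ p` is supported in the support of `x`. If
the support of `x` carries no relation at all, then `T.x` consists of all vectors with that
support, since `Kˣ` is divisible; if it is the support of a nonzero `d ∈ R`, then the invariant
`∏ xᵢ ^ dᵢ` separates infinitely many orbits with that support. Hence `(T, V)` is visible if and
only if the support of every nonzero `d ∈ R` contains that of some `p ∈ R` with `0 ≠ p ≥ 0`.

Under this condition, two vectors of `R` of minimal support have supports which are equal or
disjoint. So these supports are pairwise disjoint, every vector of `R` splits along them, and they
are the blocks `I₁, …, I_l`, while `I₀` consists of the remaining indices. Each block is the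
support of a positive relation, which says that `0` is interior to the convex hull of its weights.
-/

section LinearRelations

open Finsupp Submodule

variable {k ι E : Type*} [DivisionRing k] [AddCommGroup E] [Module k E]

/-- The space of linear relations `∑ i, d i • v i = 0` between the members of a family `v`, each
relation being recorded by its finitely supported family of coefficients `d`. -/
noncomputable def linearRelations (k : Type*) {ι E : Type*} [DivisionRing k] [AddCommGroup E]
    [Module k E] (v : ι → E) : Submodule k (ι →₀ k) :=
  LinearMap.ker (linearCombination k v)

theorem mem_linearRelations {v : ι → E} {d : ι →₀ k} :
    d ∈ linearRelations k v ↔ linearCombination k v d = 0 :=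
  LinearMap.mem_ker

theorem finrank_span_image_add_finrank_linearRelations (v : ι → E) (I : Finset ι) :
    Module.finrank k (span k (v '' (I : Set ι))) +
      Module.finrank k ↥(linearRelations k v ⊓ supported k k (I : Set ι)) = I.card := by
  have hI : Module.finrank k (supported k k (I : Set ι)) = I.card := by
    rw [(supportedEquivFinsupp (I : Set ι)).finrank_eq, Module.finrank_finsupp_self]
    exact Fintype.card_coe I
  have : FiniteDimensional k (supported k k (I : Set ι)) :=
    (supportedEquivFinsupp (I : Set ι)).symm.finiteDimensional
  have hrank := LinearMap.finrank_range_add_finrank_ker (V := supported k k (I : Set ι))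
    ((linearCombination k v).domRestrict (supported k k (I : Set ι)))
  rwa [LinearMap.range_domRestrict, ← span_image_eq_map_linearCombination,
    LinearMap.ker_domRestrict, (equivSubtypeMap _ _).finrank_eq, map_comap_subtype, hI,
    inf_comm] at hrank

theorem exists_linearMap_linearCombination_eq (v : ι → E) (I : Set ι) :
    ∃ g : E →ₗ[k] ι →₀ k, (∀ w, g w ∈ supported k k I) ∧
      ∀ w ∈ span k (v '' I), linearCombination k v (g w) = w := by
  obtain ⟨g₀, hg₀⟩ := LinearMap.exists_rightInverse_of_surjective
    (linearCombinationOn ι E k v I) (linearCombinationOn_range k I)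
  obtain ⟨g, hg⟩ := LinearMap.exists_extend (V' := supported k k I) g₀
  refine ⟨(supported k k I).subtype ∘ₗ g, fun w => (g w).2, fun w hw => ?_⟩
  have hgw : g w = g₀ ⟨w, hw⟩ := LinearMap.congr_fun hg ⟨w, hw⟩
  rw [LinearMap.comp_apply, hgw]
  exact congrArg Subtype.val (LinearMap.congr_fun hg₀ ⟨w, hw⟩)

variable {κ : Type*} {I : κ → Finset ι}

theorem span_image_univ_eq_iSup_of_cover [Fintype κ] [Fintype ι] [DecidableEq ι]
    (hcover : Finset.univ.biUnion I = Finset.univ) (v : ι → E) :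
    span k (v '' ((Finset.univ : Finset ι) : Set ι)) = ⨆ j, span k (v '' (I j : Set ι)) := by
  rw [← span_iUnion, ← Set.image_iUnion, ← hcover, Finset.coe_biUnion]
  simp only [Finset.coe_univ, Set.mem_univ, Set.iUnion_true]

theorem filter_sum_eq_of_pairwise_disjoint [DecidableEq ι]
    (hI : Pairwise fun j m => Disjoint (I j) (I m)) {s : Finset κ} {c : κ → ι →₀ k}
    (hc : ∀ m ∈ s, c m ∈ supported k k (I m : Set ι)) {j : κ} (hj : j ∈ s) :
    (∑ m ∈ s, c m).filter (· ∈ I j) = c j := by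
  rw [filter_sum, Finset.sum_eq_single_of_mem j hj, filter_eq_self_iff]
  · exact fun i hi => hc j hj (mem_support_iff.2 hi)
  · refine fun m hm hmj => filter_eq_zero_iff _ _ |>.2 fun i hij => ?_
    by_contra hi
    exact Finset.disjoint_left.1 (hI hmj) (hc m hm (mem_support_iff.2 hi)) hij

theorem sum_filter_eq_of_cover [DecidableEq ι] [Fintype κ] [Fintype ι]
    (hI : Pairwise fun j m => Disjoint (I j) (I m))
    (hcover : Finset.univ.biUnion I = Finset.univ) (d : ι →₀ k) :
    ∑ j, d.filter (· ∈ I j) = d := by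
  ext i
  obtain ⟨j, -, hij⟩ := Finset.mem_biUnion.1 (hcover ▸ Finset.mem_univ i)
  rw [Finset.sum_apply', Finset.sum_eq_single_of_mem j (Finset.mem_univ j),
    filter_apply_pos _ _ hij]
  exact fun m _ hmj => filter_apply_neg _ _ fun him => Finset.disjoint_left.1 (hI hmj) him hij

theorem iSupIndep_span_image_iff [DecidableEq ι] [Fintype κ] [Fintype ι]
    (hI : Pairwise fun j m => Disjoint (I j) (I m))
    (hcover : Finset.univ.biUnion I = Finset.univ) (v : ι → E) :
    iSupIndep (fun j => span k (v '' (I j : Set ι))) ↔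
      ∀ d ∈ linearRelations k v, ∀ j, d.filter (· ∈ I j) ∈ linearRelations k v := by
  simp only [iSupIndep_iff_finsetSum_eq_zero_imp_eq_zero, mem_span_image_iff_linearCombination,
    mem_linearRelations]
  constructor
  · intro h d hd j
    refine h Finset.univ (fun m => linearCombination k v (d.filter (· ∈ I m)))
      (fun m _ => ⟨_, fun i hi => (Finset.mem_filter.1 hi).2, rfl⟩) ?_ j (Finset.mem_univ j)
    rw [← map_sum, sum_filter_eq_of_cover hI hcover, hd]
  · intro h s x hx hsum j hj
    choose! c hc hcx using hx
    have hrel : linearCombination k v (∑ m ∈ s, c m) = 0 := by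
      rw [map_sum, Finset.sum_congr rfl hcx, hsum]
    rw [← hcx j hj, ← filter_sum_eq_of_pairwise_disjoint hI hc hj]
    exact h _ hrel j

end LinearRelations

section ElementaryVectors

open Finsupp Submodule

section DivisionRing

variable {k ι : Type*} [DivisionRing k] {R : Submodule k (ι →₀ k)} {p d : ι →₀ k}

/-- An elementary vector of a space `R` of coefficient families, in the sense of Rockafellar: a
nonzero vector of `R` of minimal support. For a space of linear relations the supports of the
elementary vectors are the circuits. -/
def IsElementaryVector (R : Submodule k (ι →₀ k)) (p : ι →₀ k) : Prop :=
  MinimalFor (fun q => q ∈ R ∧ q ≠ 0) Finsupp.support p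

theorem IsElementaryVector.of_support_subset (hp : IsElementaryVector R p) (hd : d ∈ R)
    (hd0 : d ≠ 0) (hdp : d.support ⊆ p.support) : IsElementaryVector R d :=
  ⟨⟨hd, hd0⟩, fun _ hq hqd => hdp.trans (hp.2 hq (hqd.trans hdp))⟩

theorem exists_isElementaryVector_support_subset (hd : d ∈ R) (hd0 : d ≠ 0) :
    ∃ q, IsElementaryVector R q ∧ q.support ⊆ d.support := by
  obtain ⟨q, ⟨hqR, hqd⟩, hmin⟩ := exists_minimalFor_of_wellFoundedLT
    (fun q : ι →₀ k => (q ∈ R ∧ q ≠ 0) ∧ q.support ⊆ d.support) Finsupp.support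
    ⟨d, ⟨hd, hd0⟩, subset_rfl⟩
  exact ⟨q, ⟨hqR, fun q' hq' hle => hmin ⟨hq', hle.trans hqd⟩ hle⟩, hqd⟩

theorem sub_div_smul_apply_eq_zero {i : ι} (d : ι →₀ k) (hi : i ∈ p.support) :
    (d - (d i / p i) • p) i = 0 := by
  rw [Finsupp.sub_apply, Finsupp.smul_apply, smul_eq_mul,
    div_mul_cancel₀ _ (mem_support_iff.1 hi), sub_self]

theorem support_sub_smul_subset {I : Finset ι} (hd : d.support ⊆ I) (hp : p.support ⊆ I) (t : k) :
    (d - t • p).support ⊆ I := by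
  classical
  exact support_sub.trans (Finset.union_subset hd (support_smul.trans hp))

theorem IsElementaryVector.exists_smul_eq (hp : IsElementaryVector R p) (hd : d ∈ R)
    (hdp : d.support ⊆ p.support) : ∃ t : k, t • p = d := by
  obtain ⟨i, hi⟩ := support_nonempty_iff.2 hp.1.2
  refine ⟨d i / p i, (sub_eq_zero.1 ?_).symm⟩
  by_contra hne
  have hmem : d - (d i / p i) • p ∈ R := R.sub_mem hd (R.smul_mem _ hp.1.1)
  have hip := hp.2 ⟨hmem, hne⟩ (support_sub_smul_subset hdp subset_rfl _) hi
  exact mem_support_iff.1 hip (sub_div_smul_apply_eq_zero d hi)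

theorem span_setOf_isElementaryVector (R : Submodule k (ι →₀ k)) :
    span k {p | IsElementaryVector R p} = R := by
  refine le_antisymm (span_le.2 fun p hp => hp.1.1) fun d hd => ?_
  induction hs : d.support using Finset.strongInduction generalizing d with
  | H s ih =>
    subst hs
    by_cases hd0 : d = 0
    · exact hd0 ▸ zero_mem _
    obtain ⟨q, hq, hqd⟩ := exists_isElementaryVector_support_subset hd hd0
    obtain ⟨i, hi⟩ := support_nonempty_iff.2 hq.1.2
    have hlt : (d - (d i / q i) • q).support ⊂ d.support :=
      Finset.ssubset_iff_of_subset (support_sub_smul_subset subset_rfl hqd _) |>.2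
        ⟨i, hqd hi, notMem_support_iff.2 (sub_div_smul_apply_eq_zero d hi)⟩
    have hmem := ih _ hlt _ (R.sub_mem hd (R.smul_mem _ hq.1.1)) rfl
    have hqmem : q ∈ span k {p | IsElementaryVector R p} := subset_span hq
    exact (Submodule.sub_mem_iff_left _ (smul_mem _ _ hqmem)).1 hmem

theorem filter_mem_of_forall_isElementaryVector {P : ι → Prop} [DecidablePred P]
    (hP : ∀ q, IsElementaryVector R q → (∀ i ∈ q.support, P i) ∨ ∀ i ∈ q.support, ¬P i)
    (hd : d ∈ R) : d.filter P ∈ R := by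
  rw [← span_setOf_isElementaryVector R] at hd
  induction hd using span_induction with
  | mem q hq =>
    rcases hP q hq with hqP | hqP
    · rw [(filter_eq_self_iff _ _).2 fun i hi => hqP i (mem_support_iff.2 hi)]
      exact hq.1.1
    · rw [(filter_eq_zero_iff _ _).2 fun i hi => by_contra fun h => hqP i (mem_support_iff.2 h) hi]
      exact R.zero_mem
  | zero => simpa only [filter_zero] using R.zero_mem
  | add c e _ _ hc he => simpa only [filter_add] using R.add_mem hc he
  | smul t c _ hc => simpa only [filter_smul] using R.smul_mem t hc

end DivisionRing

section Ordered

variable {k ι : Type*} [Field k] [LinearOrder k] {R : Submodule k (ι →₀ k)} {p q d e : ι →₀ k}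

/-- The support of every nonzero vector of `R` contains the support of a vector of `R` that is
nonzero with nonnegative coefficients. -/
def HasPositiveVectors (R : Submodule k (ι →₀ k)) : Prop :=
  ∀ d ∈ R, d ≠ 0 → ∃ p ∈ R, 0 < p ∧ p.support ⊆ d.support

/-- The coefficients of `e` conform to those of `d`: wherever `e` is nonzero, `d` is nonzero of the
same sign. -/
def Conforms (e d : ι →₀ k) : Prop :=
  ∀ i, (0 < e i → 0 < d i) ∧ (e i < 0 → d i < 0)

theorem Conforms.trans {c : ι →₀ k} (hcd : Conforms c d) (hde : Conforms d e) : Conforms c e :=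
  fun i => ⟨fun h => (hde i).1 ((hcd i).1 h), fun h => (hde i).2 ((hcd i).2 h)⟩

theorem Conforms.support_subset (h : Conforms e d) : e.support ⊆ d.support := by
  intro i hi
  rw [mem_support_iff] at hi ⊢
  exact hi.lt_or_gt.elim (fun hlt => ((h i).2 hlt).ne) fun hgt => ((h i).1 hgt).ne'

theorem apply_pos_of_mem_support (hp : 0 ≤ p) {i : ι} (hi : i ∈ p.support) : 0 < p i :=
  (hp i).lt_of_ne' (mem_support_iff.1 hi)

theorem conforms_of_nonneg (hp : 0 ≤ p) (h : ∀ i ∈ p.support, 0 < d i) : Conforms p d :=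
  fun i => ⟨fun hi => h i (mem_support_iff.2 hi.ne'), fun hi => absurd hi (hp i).not_gt⟩

theorem HasPositiveVectors.exists_pos_isElementaryVector (hR : HasPositiveVectors R) (hd : d ∈ R)
    (hd0 : d ≠ 0) : ∃ p, IsElementaryVector R p ∧ 0 < p ∧ p.support ⊆ d.support := by
  obtain ⟨q, hq, hqd⟩ := exists_isElementaryVector_support_subset hd hd0
  obtain ⟨p, hpR, hp, hpq⟩ := hR q hq.1.1 hq.1.2
  exact ⟨p, hq.of_support_subset hpR hp.ne' hpq, hp, hpq.trans hqd⟩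

theorem HasPositiveVectors.exists_pos_support_eq (hR : HasPositiveVectors R)
    (hp : IsElementaryVector R p) :
    ∃ q, IsElementaryVector R q ∧ 0 < q ∧ q.support = p.support := by
  obtain ⟨q, hq, hq0, hqp⟩ := hR.exists_pos_isElementaryVector hp.1.1 hp.1.2
  exact ⟨q, hq, hq0, hqp.antisymm (hp.2 hq.1 hqp)⟩

variable [IsStrictOrderedRing k]

theorem Conforms.neg (h : Conforms e d) : Conforms (-e) (-d) :=
  fun i => ⟨by simpa using (h i).2, by simpa using (h i).1⟩

theorem exists_sub_smul_conforms (hp : 0 < p) (hpd : p.support ⊆ d.support)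
    (hpos : ∃ i ∈ p.support, 0 < d i) :
    ∃ t : k, 0 < t ∧ Conforms (d - t • p) d ∧ (d - t • p).support ⊂ d.support := by
  -- `d j / p j` is the largest `t` for which `d - t • p` conforms to `d`.
  obtain ⟨j, hj, hmin⟩ := (p.support.filter (0 < d ·)).exists_min_image (fun i => d i / p i)
    (hpos.imp fun i hi => Finset.mem_filter.2 hi)
  obtain ⟨hjp, hjd⟩ := Finset.mem_filter.1 hj
  have ht : 0 < d j / p j := div_pos hjd (apply_pos_of_mem_support hp.le hjp)
  have hconf : Conforms (d - (d j / p j) • p) d := by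
    intro i
    rw [Finsupp.sub_apply, Finsupp.smul_apply, smul_eq_mul, sub_pos, sub_neg]
    refine ⟨(mul_nonneg ht.le (hp.le i)).trans_lt, fun h => ?_⟩
    by_cases hi : i ∈ p.support
    · refine lt_of_le_of_ne (le_of_not_gt fun hdi => h.not_ge ?_) (mem_support_iff.1 (hpd hi))
      exact (le_div_iff₀ (apply_pos_of_mem_support hp.le hi)).1
        (hmin i (Finset.mem_filter.2 ⟨hi, hdi⟩))
    · rwa [notMem_support_iff.1 hi, mul_zero] at h
  exact ⟨_, ht, hconf, Finset.ssubset_iff_of_subset hconf.support_subset |>.2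
    ⟨j, hpd hjp, notMem_support_iff.2 (sub_div_smul_apply_eq_zero d hjp)⟩⟩

theorem HasPositiveVectors.exists_conforms (hR : HasPositiveVectors R) (hd : d ∈ R) (hd0 : d ≠ 0) :
    ∃ q ∈ R, 0 < q ∧ (Conforms q d ∨ Conforms q (-d)) := by
  induction hs : d.support using Finset.strongInduction generalizing d with
  | H s ih =>
    subst hs
    obtain ⟨p, hpR, hp, hpd⟩ := hR d hd hd0
    by_cases hpos : ∃ i ∈ p.support, 0 < d i
    · obtain ⟨t, ht, hconf, hlt⟩ := exists_sub_smul_conforms hp hpd hpos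
      by_cases h0 : d - t • p = 0
      · refine ⟨p, hpR, hp, .inl <| conforms_of_nonneg hp.le fun i hi => ?_⟩
        rw [sub_eq_zero.1 h0, Finsupp.smul_apply, smul_eq_mul]
        exact mul_pos ht (apply_pos_of_mem_support hp.le hi)
      · obtain ⟨q, hqR, hq, hqd⟩ := ih _ hlt (R.sub_mem hd (R.smul_mem t hpR)) h0 rfl
        exact ⟨q, hqR, hq, hqd.imp (·.trans hconf) (·.trans hconf.neg)⟩
    · push Not at hpos
      refine ⟨p, hpR, hp, .inr <| conforms_of_nonneg hp.le fun i hi => ?_⟩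
      exact neg_pos.2 ((hpos i hi).lt_of_ne (mem_support_iff.1 (hpd hi)))

theorem HasPositiveVectors.support_subset_of_not_disjoint (hR : HasPositiveVectors R)
    (hp : IsElementaryVector R p) (hq : IsElementaryVector R q)
    (hpq : ¬Disjoint p.support q.support) : p.support ⊆ q.support := by
  obtain ⟨p', hp', hp'0, hpp'⟩ := hR.exists_pos_support_eq hp
  obtain ⟨q', hq', hq'0, hqq'⟩ := hR.exists_pos_support_eq hq
  rw [← hpp', ← hqq'] at hpq ⊢
  obtain ⟨i, hip, hiq⟩ := Finset.not_disjoint_iff.1 hpq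
  have hi := sub_div_smul_apply_eq_zero p' hiq
  have ht : 0 ≤ p' i / q' i := div_nonneg (hp'0.le i) (hq'0.le i)
  generalize p' i / q' i = t at hi ht
  by_cases hd0 : p' - t • q' = 0
  · rw [sub_eq_zero.1 hd0]
    exact support_smul
  -- A positive `e` conforming to `p' - t • q'` would contradict the minimality of `p'`, and one
  -- conforming to `t • q' - p'` that of `q'`, because `e` vanishes at `i`.
  exfalso
  obtain ⟨e, heR, he, hed | hed⟩ :=
    hR.exists_conforms (R.sub_mem hp'.1.1 (R.smul_mem t hq'.1.1)) hd0
  · have hep : Conforms e p' := conforms_of_nonneg he.le fun j hj => by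
      have hj := (hed j).1 (apply_pos_of_mem_support he.le hj)
      exact (mul_nonneg ht (hq'0.le j)).trans_lt (sub_pos.1 hj)
    exact mem_support_iff.1 (hed.support_subset (hp'.2 ⟨heR, he.ne'⟩ hep.support_subset hip)) hi
  · have heq : e.support ⊆ q'.support := fun j hj => by
      have hj := (hed j).1 (apply_pos_of_mem_support he.le hj)
      rw [neg_sub] at hj
      exact mem_support_iff.2
        (right_ne_zero_of_mul ((hp'0.le j).trans_lt (sub_pos.1 hj)).ne')
    have hie := hed.support_subset (hq'.2 ⟨heR, he.ne'⟩ heq hiq)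
    rw [support_neg] at hie
    exact mem_support_iff.1 hie hi

theorem HasPositiveVectors.support_eq_or_disjoint (hR : HasPositiveVectors R)
    (hp : IsElementaryVector R p) (hq : IsElementaryVector R q) :
    p.support = q.support ∨ Disjoint p.support q.support :=
  or_iff_not_imp_right.2 fun h => (hR.support_subset_of_not_disjoint hp hq h).antisymm
    (hR.support_subset_of_not_disjoint hq hp fun h' => h h'.symm)

end Ordered
end ElementaryVectors

section Partitions

open Finsupp Submodule

theorem exists_partition_of_pairwiseDisjoint {ι : Type*} [Fintype ι] [DecidableEq ι]
    (𝒞 : Finset (Finset ι)) (h𝒞 : (𝒞 : Set (Finset ι)).PairwiseDisjoint id) :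
    ∃ (l : ℕ) (I : Fin (l + 1) → Finset ι), (Pairwise fun j m => Disjoint (I j) (I m)) ∧
      Finset.univ.biUnion I = Finset.univ ∧ (∀ C ∈ 𝒞, Disjoint (I 0) C) ∧ ∀ j ≠ 0, I j ∈ 𝒞 := by
  have h0 : ∀ C ∈ 𝒞, Disjoint (𝒞.biUnion id)ᶜ C := fun C hC =>
    disjoint_compl_left_iff.2 (Finset.subset_biUnion_of_mem id hC)
  have hC : ∀ j, (𝒞.equivFin.symm j : Finset ι) ∈ 𝒞 := fun j => (𝒞.equivFin.symm j).2
  refine ⟨𝒞.card, Fin.cons (𝒞.biUnion id)ᶜ fun j => 𝒞.equivFin.symm j, ?_, ?_, h0, ?_⟩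
  · intro j m hjm
    cases j using Fin.cases <;> cases m using Fin.cases
    · exact absurd rfl hjm
    · exact h0 _ (hC _)
    · exact (h0 _ (hC _)).symm
    · exact h𝒞 (hC _) (hC _) fun h => hjm (congrArg Fin.succ
        (𝒞.equivFin.symm.injective (Subtype.ext h)))
  · refine Finset.eq_univ_iff_forall.2 fun i => Finset.mem_biUnion.2 ?_
    by_cases hi : i ∈ 𝒞.biUnion id
    · obtain ⟨C, hC, hiC⟩ := Finset.mem_biUnion.1 hi
      exact ⟨(𝒞.equivFin ⟨C, hC⟩).succ, Finset.mem_univ _, by simpa using hiC⟩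
    · exact ⟨0, Finset.mem_univ _, Finset.mem_compl.2 hi⟩
  · exact fun j hj => Fin.cases (fun h => absurd rfl h) (fun j _ => hC j) j hj

variable {k ι : Type*} [Field k] [LinearOrder k] {R : Submodule k (ι →₀ k)} {l : ℕ}
  {I : Fin (l + 1) → Finset ι}

/-- A partition of the index set into blocks along which `R` decomposes: the block `I 0` carries no
nonzero vector of `R`, and every other block carries a line, spanned by a vector that is positive
exactly on that block. -/
structure IsPositiveCircuitPartition [Fintype ι] [DecidableEq ι] (R : Submodule k (ι →₀ k)) {l : ℕ}
    (I : Fin (l + 1) → Finset ι) : Prop where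
  pairwise_disjoint : Pairwise fun j m => Disjoint (I j) (I m)
  biUnion_eq_univ : Finset.univ.biUnion I = Finset.univ
  filter_mem : ∀ d ∈ R, ∀ j, d.filter (· ∈ I j) ∈ R
  inf_supported_zero : R ⊓ supported k k (I 0 : Set ι) = ⊥
  finrank_inf_supported : ∀ j ≠ 0, Module.finrank k ↥(R ⊓ supported k k (I j : Set ι)) = 1
  exists_pos : ∀ j ≠ 0, ∃ p ∈ R, 0 < p ∧ p.support = I j

variable [Fintype ι] [DecidableEq ι]

theorem IsPositiveCircuitPartition.hasPositiveVectors (hI : IsPositiveCircuitPartition R I) :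
    HasPositiveVectors R := by
  intro d hd hd0
  obtain ⟨i, hi⟩ := support_nonempty_iff.2 hd0
  obtain ⟨j, -, hij⟩ := Finset.mem_biUnion.1 (hI.biUnion_eq_univ ▸ Finset.mem_univ i)
  have hfilter : d.filter (· ∈ I j) ∈ R ⊓ supported k k (I j : Set ι) :=
    ⟨hI.filter_mem d hd j, fun m hm => (Finset.mem_filter.1 hm).2⟩
  have hi0 : d.filter (· ∈ I j) i ≠ 0 := by
    rwa [filter_apply_pos _ _ hij, ← mem_support_iff]
  have hj : j ≠ 0 := by
    rintro rfl
    rw [hI.inf_supported_zero, mem_bot] at hfilter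
    exact hi0 (DFunLike.congr_fun hfilter i)
  obtain ⟨p, hpR, hp, hpI⟩ := hI.exists_pos j hj
  have hpmem : p ∈ R ⊓ supported k k (I j : Set ι) := ⟨hpR, hpI.subset⟩
  obtain ⟨t, ht⟩ := (finrank_eq_one_iff_of_nonzero' (⟨p, hpmem⟩ : ↥(R ⊓ _))
    (by simpa using hp.ne')).1 (hI.finrank_inf_supported j hj) ⟨_, hfilter⟩
  replace ht : t • p = d.filter (· ∈ I j) := congrArg Subtype.val ht
  refine ⟨p, hpR, hp, fun m hm => ?_⟩
  have ht0 : t ≠ 0 := by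
    rintro rfl
    rw [← ht, zero_smul] at hi0
    exact hi0 rfl
  have hm : m ∈ (d.filter (· ∈ I j)).support := by
    rwa [← ht, support_smul_eq ht0]
  exact (Finset.mem_filter.1 hm).1

variable [IsStrictOrderedRing k]

theorem HasPositiveVectors.exists_partition (hR : HasPositiveVectors R) :
    ∃ (l : ℕ) (I : Fin (l + 1) → Finset ι), IsPositiveCircuitPartition R I := by
  classical
  let 𝒞 : Finset (Finset ι) := {C | ∃ p, IsElementaryVector R p ∧ p.support = C}
  have mem𝒞 : ∀ {C}, C ∈ 𝒞 ↔ ∃ p, IsElementaryVector R p ∧ p.support = C := by simp [𝒞]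
  have h𝒞 : (𝒞 : Set (Finset ι)).PairwiseDisjoint id := by
    intro C hC D hD hCD
    obtain ⟨p, hp, rfl⟩ := mem𝒞.1 hC
    obtain ⟨q, hq, rfl⟩ := mem𝒞.1 hD
    exact (hR.support_eq_or_disjoint hp hq).resolve_left hCD
  obtain ⟨l, I, hdisj, hcover, h0, hI⟩ := exists_partition_of_pairwiseDisjoint 𝒞 h𝒞
  have hdich : ∀ j q, IsElementaryVector R q →
      (∀ i ∈ q.support, i ∈ I j) ∨ ∀ i ∈ q.support, i ∉ I j := by
    intro j q hq
    obtain rfl | hj := eq_or_ne j 0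
    · exact .inr fun i hi => Finset.disjoint_right.1 (h0 _ (mem𝒞.2 ⟨q, hq, rfl⟩)) hi
    · obtain ⟨p, hp, hpI⟩ := mem𝒞.1 (hI j hj)
      rw [← hpI]
      exact (hR.support_eq_or_disjoint hq hp).imp (fun h _ hi => h.subset hi)
        fun h _ hi => Finset.disjoint_left.1 h hi
  refine ⟨l, I, hdisj, hcover, fun d hd j =>
    filter_mem_of_forall_isElementaryVector (hdich j) hd, ?_, fun j hj => ?_,
    fun j hj => ?_⟩
  · refine (Submodule.eq_bot_iff _).2 fun d hd => by_contra fun hd0 => ?_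
    obtain ⟨q, hq, hqd⟩ := exists_isElementaryVector_support_subset hd.1 hd0
    exact hq.1.2 (support_eq_empty.1 (((h0 _ (mem𝒞.2 ⟨q, hq, rfl⟩)).symm.eq_bot_of_le
      (hqd.trans hd.2))))
  · obtain ⟨p, hp, hpI⟩ := mem𝒞.1 (hI j hj)
    have hpmem : p ∈ R ⊓ supported k k (I j : Set ι) := ⟨hp.1.1, hpI.subset⟩
    refine (finrank_eq_one_iff_of_nonzero' (⟨p, hpmem⟩ : ↥(R ⊓ _)) (by simpa using hp.1.2)).2
      fun d => ?_
    obtain ⟨t, ht⟩ := hp.exists_smul_eq d.2.1 (hpI.symm ▸ d.2.2)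
    exact ⟨t, Subtype.ext ht⟩
  · obtain ⟨p, hp, hpI⟩ := mem𝒞.1 (hI j hj)
    obtain ⟨q, hq, hq0, hqp⟩ := hR.exists_pos_support_eq hp
    exact ⟨q, hq.1.1, hq0, hqp.trans hpI⟩

theorem hasPositiveVectors_iff_exists_partition :
    HasPositiveVectors R ↔
      ∃ (l : ℕ) (I : Fin (l + 1) → Finset ι), IsPositiveCircuitPartition R I :=
  ⟨HasPositiveVectors.exists_partition, fun ⟨_, _, hI⟩ => hI.hasPositiveVectors⟩

end Partitions

section ConvexHull

open Finsupp Submodule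

theorem exists_nonneg_linearCombination_eq_of_mem_convexHull {k ι E : Type*} [Field k]
    [LinearOrder k] [IsStrictOrderedRing k] [AddCommGroup E] [Module k E] {v : ι → E}
    {I : Set ι} {x : E} (hx : x ∈ convexHull k (v '' I)) :
    ∃ c ∈ supported k k I, 0 ≤ c ∧ linearCombination k v c = x := by
  refine convexHull_min (s := v '' I)
    (t := {x | ∃ c ∈ supported k k I, 0 ≤ c ∧ linearCombination k v c = x}) ?_ ?_ hx
  · rintro _ ⟨i, hi, rfl⟩
    exact ⟨single i 1, single_mem_supported k 1 hi, single_nonneg.2 zero_le_one, by simp⟩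
  · rintro _ ⟨c, hcI, hc, rfl⟩ _ ⟨d, hdI, hd, rfl⟩ a b ha hb -
    exact ⟨a • c + b • d, add_mem (smul_mem _ a hcI) (smul_mem _ b hdI),
      add_nonneg (smul_nonneg ha hc) (smul_nonneg hb hd), by simp⟩

variable {ι : Type*} {r : ℕ} {v : ι → Fin r → ℚ} {I : Finset ι}

theorem exists_pos_relation_of_zero_mem_convexHullInterior
    (h : (0 : Fin r → ℚ) ∈ convexHullInterior (v '' (I : Set ι))) :
    ∃ p ∈ linearRelations ℚ v, 0 < p ∧ p.support = I := by
  obtain ⟨w, hw, hw0⟩ := h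
  obtain rfl : w = 0 := Subtype.ext hw0
  have hnhds := mem_interior_iff_mem_nhds.1 hw
  have hull := mem_of_mem_nhds hnhds
  have hI : I.Nonempty := by
    simpa using convexHull_nonempty_iff.1 ⟨((0 : span ℚ (v '' (I : Set ι))) : Fin r → ℚ), hull⟩
  -- A nonnegative combination equal to `-ε • ∑ i ∈ I, v i`, moved to the left hand side, gives a
  -- relation whose coefficients on `I` are at least `ε`.
  let u : ι →₀ ℚ := indicator I fun _ _ => 1
  have hu : linearCombination ℚ v u ∈ span ℚ (v '' (I : Set ι)) :=
    (mem_span_image_iff_linearCombination ℚ).2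
      ⟨u, (mem_supported ℚ u).2 (support_indicator_subset _ _), rfl⟩
  obtain ⟨ε, hmem, hε⟩ : ∃ ε : ℚ, ε • -linearCombination ℚ v u ∈ convexHull ℚ (v '' (I : Set ι)) ∧
      0 < ε := by
    have hcont : Continuous fun ε : ℚ => ε • -(⟨_, hu⟩ : span ℚ (v '' (I : Set ι))) := by fun_prop
    exact (((hcont.tendsto' 0 0 (zero_smul ℚ _)).eventually
      hnhds).filter_mono nhdsWithin_le_nhds |>.and
      (self_mem_nhdsWithin : Set.Ioi (0 : ℚ) ∈ nhdsWithin 0 (Set.Ioi 0))).exists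
  obtain ⟨c, hcI, hc, hcv⟩ := exists_nonneg_linearCombination_eq_of_mem_convexHull hmem
  have hpos : ∀ i ∈ I, 0 < (c + ε • u) i := fun i hi => by
    simpa [u, indicator_of_mem hi] using add_pos_of_nonneg_of_pos (hc i) hε
  have hzero : ∀ i ∉ I, (c + ε • u) i = 0 := fun i hi => by
    have hci : c i = 0 := notMem_support_iff.1 fun h => hi (hcI h)
    simp [u, indicator_of_notMem hi, hci]
  have hsupp : (c + ε • u).support = I := Finset.ext fun i =>
    ⟨fun h => by_contra fun hi => mem_support_iff.1 h (hzero i hi),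
      fun hi => mem_support_iff.2 (hpos i hi).ne'⟩
  refine ⟨c + ε • u, mem_linearRelations.2 ?_, lt_of_le_of_ne (fun i => ?_) fun h => ?_, hsupp⟩
  · rw [map_add, map_smul, hcv, smul_neg, neg_add_cancel]
  · exact (em (i ∈ I)).elim (fun hi => (hpos i hi).le) fun hi => (hzero i hi).ge
  · rw [← h, support_zero] at hsupp
    exact hI.ne_empty hsupp.symm

theorem zero_mem_convexHullInterior_of_pos_relation {p : ι →₀ ℚ}
    (hpv : p ∈ linearRelations ℚ v) (hp : 0 < p) (hpI : p.support = I) :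
    (0 : Fin r → ℚ) ∈ convexHullInterior (v '' (I : Set ι)) := by
  obtain ⟨g, hgI, hg⟩ := exists_linearMap_linearCombination_eq (k := ℚ) v (I : Set ι)
  have hP : 0 < ∑ i ∈ I, p i := Finset.sum_pos
    (fun i hi => apply_pos_of_mem_support hp.le (hpI.symm ▸ hi))
    (hpI ▸ support_nonempty_iff.2 hp.ne')
  -- Correcting `g w` by a multiple of `p` makes the coefficients sum to `1`.
  let c (w : Fin r → ℚ) : ι →₀ ℚ := g w + ((1 - ∑ i ∈ I, g w i) / ∑ i ∈ I, p i) • p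
  have hcont (i : ι) : Continuous fun w => c w i := by
    have hgi (i : ι) : Continuous fun w => g w i :=
      LinearMap.continuous_on_pi (lapply i ∘ₗ g)
    exact (hgi i).add (((continuous_const.sub (continuous_finsetSum _ fun m _ => hgi m)).div_const
      _).mul continuous_const)
  have hpos : ∀ᶠ w : span ℚ (v '' (I : Set ι)) in nhds 0, ∀ i ∈ I, 0 < c w i := by
    refine (Filter.eventually_all_finset I).2 fun i hi =>
      (((hcont i).comp continuous_subtype_val).tendsto 0).eventually (lt_mem_nhds ?_)
    simpa [c] using mul_pos (inv_pos.2 hP) (apply_pos_of_mem_support hp.le (hpI.symm ▸ hi))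
  refine ⟨0, mem_interior_iff_mem_nhds.2 ?_, rfl⟩
  filter_upwards [hpos] with w hw
  have hsum : ∑ i ∈ I, c w i = 1 := by
    simp only [c, Finsupp.add_apply, Finsupp.smul_apply, smul_eq_mul, Finset.sum_add_distrib,
      ← Finset.mul_sum]
    rw [div_mul_cancel₀ _ hP.ne']
    ring
  have hcI : c w ∈ supported ℚ ℚ (I : Set ι) :=
    add_mem (hgI w) (smul_mem _ _ ((mem_supported ℚ p).2 (by rw [hpI])))
  have hcomb : ∑ i ∈ I, c w i • v i = w := by
    rw [← linearCombination_apply_of_mem_supported ℚ hcI, map_add, map_smul,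
      mem_linearRelations.1 hpv, smul_zero, add_zero, hg w w.2]
  change (w : Fin r → ℚ) ∈ convexHull ℚ _
  rw [← hcomb]
  exact (convex_convexHull ℚ _).sum_mem (fun i hi => (hw i hi).le) hsum
    fun i hi => subset_convexHull _ _ ⟨i, hi, rfl⟩

theorem zero_mem_convexHullInterior_iff :
    (0 : Fin r → ℚ) ∈ convexHullInterior (v '' (I : Set ι)) ↔
      ∃ p ∈ linearRelations ℚ v, 0 < p ∧ p.support = I :=
  ⟨exists_pos_relation_of_zero_mem_convexHullInterior, fun ⟨_, hpv, hp, hpI⟩ =>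
    zero_mem_convexHullInterior_of_pos_relation hpv hp hpI⟩

end ConvexHull

section PartitionCriterion

open Submodule

theorem isPositiveCircuitPartition_linearRelations_iff {ι : Type*} [Fintype ι] [DecidableEq ι]
    {r l : ℕ} {v : ι → Fin r → ℚ} {I : Fin (l + 1) → Finset ι} :
    IsPositiveCircuitPartition (linearRelations ℚ v) I ↔
      (Pairwise fun j m => Disjoint (I j) (I m)) ∧
      (Finset.univ.biUnion I = Finset.univ) ∧
      (iSupIndep (fun j => span ℚ (v '' (I j : Set ι))) ∧
        span ℚ (v '' ((Finset.univ : Finset ι) : Set ι)) = ⨆ j, span ℚ (v '' (I j : Set ι))) ∧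
      (Module.finrank ℚ (span ℚ (v '' (I 0 : Set ι))) = (I 0).card ∧
        ∀ j, j ≠ 0 → Module.finrank ℚ (span ℚ (v '' (I j : Set ι))) + 1 = (I j).card) ∧
      (∀ j, j ≠ 0 → (0 : Fin r → ℚ) ∈ convexHullInterior (v '' (I j : Set ι))) := by
  have hrank (j) := finrank_span_image_add_finrank_linearRelations (k := ℚ) v (I j)
  have hzero : Module.finrank ℚ (span ℚ (v '' (I 0 : Set ι))) = (I 0).card ↔
      linearRelations ℚ v ⊓ Finsupp.supported ℚ ℚ (I 0 : Set ι) = ⊥ := by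
    rw [← finrank_eq_zero (R := ℚ), ← hrank 0, left_eq_add]
  have hone (j) : Module.finrank ℚ (span ℚ (v '' (I j : Set ι))) + 1 = (I j).card ↔
      Module.finrank ℚ ↥(linearRelations ℚ v ⊓ Finsupp.supported ℚ ℚ (I j : Set ι)) = 1 := by
    rw [← hrank j, add_right_inj, eq_comm]
  simp only [hzero, hone, zero_mem_convexHullInterior_iff]
  constructor
  · intro h
    exact ⟨h.pairwise_disjoint, h.biUnion_eq_univ,
      ⟨(iSupIndep_span_image_iff h.pairwise_disjoint h.biUnion_eq_univ v).2 h.filter_mem,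
        span_image_univ_eq_iSup_of_cover h.biUnion_eq_univ v⟩,
      ⟨h.inf_supported_zero, h.finrank_inf_supported⟩, h.exists_pos⟩
  · rintro ⟨hdisj, hcover, ⟨hind, -⟩, ⟨hbot, hline⟩, hpos⟩
    exact ⟨hdisj, hcover, (iSupIndep_span_image_iff hdisj hcover v).1 hind, hbot, hline, hpos⟩

end PartitionCriterion

theorem sum_filter_eq_zero_of_linearIndependent {R M κ α : Type*} [Semiring R] [AddCommMonoid M]
    [Module R M] [DecidableEq κ] {f : κ → M} (hf : LinearIndependent R f) {u : Finset α}
    {a : α → R} {χ : α → κ} (h : ∑ m ∈ u, a m • f (χ m) = 0) (ψ : κ) :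
    ∑ m ∈ u with χ m = ψ, a m = 0 := by
  have hzero : ∑ m ∈ u, Finsupp.single (χ m) (a m) = 0 := hf (by simpa using h)
  simpa [Finset.sum_apply', Finsupp.single_apply, Finset.sum_filter] using
    DFunLike.congr_fun hzero ψ

section AlgebraicallyClosed

variable {K : Type*} [Field K] [IsAlgClosed K]

theorem infinite_units_of_infinite (K : Type*) [Field K] [Infinite K] : Infinite Kˣ :=
  unitsEquivNeZero.infinite_iff.2 (Set.finite_singleton (0 : K)).infinite_compl.to_subtype

theorem exists_units_pow_eq {n : ℕ} (hn : n ≠ 0) (a : Kˣ) : ∃ z : Kˣ, z ^ n = a := by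
  obtain ⟨z, hz⟩ := IsAlgClosed.exists_pow_nat_eq (a : K) (Nat.pos_of_ne_zero hn)
  have hz0 : z ≠ 0 := by
    rintro rfl
    exact a.ne_zero (hz ▸ zero_pow hn)
  exact ⟨Units.mk0 z hz0, Units.ext (by simpa using hz)⟩

theorem exists_units_zpow_eq {z : ℤ} (hz : z ≠ 0) (a : Kˣ) : ∃ y : Kˣ, y ^ z = a := by
  obtain ⟨y, hy⟩ := exists_units_pow_eq (Int.natAbs_ne_zero.2 hz) a
  obtain h | h := Int.natAbs_eq z
  · exact ⟨y, by rw [h, zpow_natCast, hy]⟩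
  · exact ⟨y⁻¹, by rw [h, zpow_neg, zpow_natCast, inv_pow, inv_inv, hy]⟩

theorem exists_support_eq_prod_zpow_eq {ι : Type*} {e : ι →₀ ℤ} (he : e ≠ 0) (a : Kˣ) :
    ∃ c : ι →₀ K, c.support = e.support ∧ (e.prod fun i z => c i ^ z) = a := by
  classical
  obtain ⟨j, hj⟩ := Finsupp.support_nonempty_iff.2 he
  obtain ⟨y, hy⟩ := exists_units_zpow_eq (Finsupp.mem_support_iff.1 hj) a
  refine ⟨Finsupp.indicator e.support fun i _ =>
    ((Pi.mulSingle j y : ι → Kˣ) i : K), ?_, ?_⟩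
  · ext i
    by_cases hi : i ∈ e.support <;> simp_all
  · rw [Finsupp.prod, Finset.prod_eq_single_of_mem j hj fun i hi hij => ?_]
    · simp [Finsupp.indicator_of_mem hj, ← hy]
    · simp [Finsupp.indicator_of_mem hi, hij]

end AlgebraicallyClosed

section Zariski

variable {K V ι : Type*} [Field K] [AddCommGroup V] [Module K V] {S : Set V} {x : V}

theorem mem_zariskiClosure_iff :
    x ∈ zariskiClosure K S ↔
      ∀ f ∈ polynomialFunctionAlgebra K V, (∀ y ∈ S, f y = 0) → f x = 0 := by
  constructor
  · intro h f hf hS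
    exact h {v | ∀ p ∈ ({f} : Set (V → K)), p v = 0}
      ⟨⟨{f}, by simpa using hf, rfl⟩, fun y hy => by simpa using hS y hy⟩ f rfl
  · rintro h Z ⟨⟨F, hF, rfl⟩, hS⟩ f hf
    exact h f (hF hf) fun y hy => hS hy f hf

theorem polynomialFunctionAlgebra_eq_range_aeval [Finite ι] (b : Module.Basis ι K V) :
    polynomialFunctionAlgebra K V =
      (MvPolynomial.aeval (R := K) fun i => (b.coord i : V → K)).range := by
  have := Fintype.ofFinite ι
  rw [← Algebra.adjoin_range_eq_range_aeval]
  refine le_antisymm (Algebra.adjoin_le ?_) (Algebra.adjoin_mono ?_)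
  · rintro _ ⟨f, rfl⟩
    have hf : ∑ i, f (b i) • (b.coord i : V → K) = f := by
      ext y
      conv_rhs => rw [← b.sum_dual_apply_smul_coord f]
      simp only [Finset.sum_apply, LinearMap.sum_apply, Pi.smul_apply, LinearMap.smul_apply]
    change (f : V → K) ∈ _
    rw [← hf]
    exact sum_mem fun i _ => Subalgebra.smul_mem _ (Algebra.subset_adjoin (Set.mem_range_self i)) _
  · rintro _ ⟨i, rfl⟩
    exact ⟨b.coord i, rfl⟩

theorem mem_zariskiClosure_iff_eval [Finite ι] (b : Module.Basis ι K V) :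
    x ∈ zariskiClosure K S ↔ ∀ F : MvPolynomial ι K,
      (∀ y ∈ S, MvPolynomial.eval (b.repr y) F = 0) → MvPolynomial.eval (b.repr x) F = 0 := by
  have heval (F : MvPolynomial ι K) (y : V) :
      MvPolynomial.aeval (fun i => (b.coord i : V → K)) F y = MvPolynomial.eval (b.repr y) F :=
    MvPolynomial.comp_aeval_apply _ (Pi.evalAlgHom K (fun _ : V => K) y) F
  rw [mem_zariskiClosure_iff, polynomialFunctionAlgebra_eq_range_aeval b]
  simp only [AlgHom.mem_range, forall_exists_index, forall_apply_eq_imp_iff, heval]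

end Zariski

section Eigenbases

open Representation

variable {K G V ι : Type*} [Field K] [Group G] [AddCommGroup V] [Module K V]
  {ρ : Representation K G V} {χ : ι → G →* Kˣ} {b : Module.Basis ι K V}

/-- The group acts diagonally in the basis `b`, through the character `χ i` on the vector `b i`. -/
def IsEigenbasis (ρ : Representation K G V) (χ : ι → G →* Kˣ) (b : Module.Basis ι K V) : Prop :=
  ∀ g i, ρ g (b i) = (χ i g : K) • b i

theorem IsEigenbasis.repr_apply (hb : IsEigenbasis ρ χ b) (g : G) (x : V) (i : ι) :
    b.repr (ρ g x) i = χ i g * b.repr x i := by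
  have hcoord : b.coord i ∘ₗ ρ g = (χ i g : K) • b.coord i := b.ext fun j => by
    obtain rfl | hij := eq_or_ne j i
    · simp [hb g j]
    · simp [hb g j, hij]
  exact LinearMap.congr_fun hcoord x

theorem IsEigenbasis.support_repr_apply (hb : IsEigenbasis ρ χ b) (g : G) (x : V) :
    (b.repr (ρ g x)).support = (b.repr x).support := by
  ext i
  simp [hb.repr_apply]

theorem IsEigenbasis.prod_repr_pow (hb : IsEigenbasis ρ χ b) (g : G) (x : V) (m : ι →₀ ℕ) :
    (m.prod fun i k => b.repr (ρ g x) i ^ k) =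
      ((m.prod fun i k => χ i ^ k) g : K) * m.prod fun i k => b.repr x i ^ k := by
  simp [hb.repr_apply, mul_pow, Finsupp.prod, Finset.prod_mul_distrib]

theorem IsEigenbasis.prod_repr_zpow (hb : IsEigenbasis ρ χ b) (g : G) (x : V) (e : ι →₀ ℤ) :
    (e.prod fun i z => b.repr (ρ g x) i ^ z) =
      ((e.prod fun i z => χ i ^ z) g : K) * e.prod fun i z => b.repr x i ^ z := by
  simp [hb.repr_apply, mul_zpow, Finsupp.prod, Finset.prod_mul_distrib]

theorem IsEigenbasis.eq_zero_of_isNilpotentVector [Finite ι] (hb : IsEigenbasis ρ χ b) {x : V}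
    (hx : ρ.IsNilpotentVector x) {m : ι →₀ ℕ} (hmx : m.support ⊆ (b.repr x).support)
    (hm : (m.prod fun i k => χ i ^ k) = 1) : m = 0 := by
  by_contra hm0
  obtain ⟨i, hi⟩ := Finsupp.support_nonempty_iff.2 hm0
  let c := m.prod fun i k => b.repr x i ^ k
  have hc : c ≠ 0 := Finset.prod_ne_zero_iff.2 fun i hi =>
    pow_ne_zero _ (Finsupp.mem_support_iff.1 (hmx hi))
  have hzero := (mem_zariskiClosure_iff_eval b).1 hx (.monomial m 1 - .C c) <| by
    rintro _ ⟨g, rfl⟩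
    simp only [map_sub, MvPolynomial.eval_monomial, MvPolynomial.eval_C, hb.prod_repr_pow, hm]
    simp [c]
  have hprod : (m.prod fun i k => b.repr 0 i ^ k) = 0 := Finset.prod_eq_zero hi (by
    simpa using Finsupp.mem_support_iff.1 hi)
  rw [map_sub, MvPolynomial.eval_monomial, MvPolynomial.eval_C, hprod, mul_zero, zero_sub,
    neg_eq_zero] at hzero
  exact hc hzero

theorem IsEigenbasis.isNilpotentVector [Finite ι] (hb : IsEigenbasis ρ χ b) {x : V}
    (hx : ∀ m : ι →₀ ℕ, m.support ⊆ (b.repr x).support → (m.prod fun i k => χ i ^ k) = 1 → m = 0) :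
    ρ.IsNilpotentVector x := by
  classical
  refine (mem_zariskiClosure_iff_eval b).2 fun F hF => ?_
  let a (m : ι →₀ ℕ) : K := F.coeff m * m.prod fun i k => b.repr x i ^ k
  have hsum : ∑ m ∈ F.support,
      a m • ⇑((Units.coeHom K).comp (m.prod fun i k => χ i ^ k)) = 0 := by
    ext g
    rw [Pi.zero_apply, ← hF (ρ g x) ⟨g, rfl⟩, MvPolynomial.eval_eq, Finset.sum_apply]
    refine Finset.sum_congr rfl fun m _ => ?_
    change a m * _ = F.coeff m * m.prod fun i k => b.repr (ρ g x) i ^ k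
    rw [hb.prod_repr_pow]
    simp only [a, MonoidHom.coe_comp, Function.comp_apply, Units.coeHom_apply]
    ring
  -- The part of the sum with trivial character vanishes, and only `m = 0` contributes to it.
  have hfilter := sum_filter_eq_zero_of_linearIndependent (linearIndependent_monoidHom G K) hsum 1
  rw [Finset.sum_eq_single 0] at hfilter
  · simpa [a, MvPolynomial.eval_zero, MvPolynomial.constantCoeff_eq] using hfilter
  · intro m hm hm0
    by_contra ham
    have hχ : (m.prod fun i k => χ i ^ k) = 1 := by
      ext g
      exact DFunLike.congr_fun (Finset.mem_filter.1 hm).2 g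
    refine hm0 (hx m (fun i hi => ?_) hχ)
    have hi0 := Finset.prod_ne_zero_iff.1 (right_ne_zero_of_mul ham) i hi
    exact Finsupp.mem_support_iff.2 (ne_zero_pow (Finsupp.mem_support_iff.1 hi) hi0)
  · intro h0
    have hF0 : F.coeff 0 = 0 := MvPolynomial.notMem_support_iff.1 fun h =>
      h0 (Finset.mem_filter.2 ⟨h, by ext; simp⟩)
    simp [a, hF0]

theorem IsEigenbasis.isNilpotentVector_iff [Finite ι] (hb : IsEigenbasis ρ χ b) {x : V} :
    ρ.IsNilpotentVector x ↔ ∀ m : ι →₀ ℕ, m.support ⊆ (b.repr x).support →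
      (m.prod fun i k => χ i ^ k) = 1 → m = 0 :=
  ⟨fun hx _ hmx hm => hb.eq_zero_of_isNilpotentVector hx hmx hm, hb.isNilpotentVector⟩

theorem IsEigenbasis.infinite_orbits [IsAlgClosed K] (hb : IsEigenbasis ρ χ b) {e : ι →₀ ℤ}
    (he0 : e ≠ 0) (he : (e.prod fun i z => χ i ^ z) = 1) :
    {O | ∃ x, (b.repr x).support = e.support ∧ O = ρ.orbitOf x}.Infinite := by
  have := IsAlgClosed.instInfinite (K := K)
  have := infinite_units_of_infinite K
  choose c hce hc using fun a : Kˣ => exists_support_eq_prod_zpow_eq he0 a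
  have hinv (a : Kˣ) : b.repr (b.repr.symm (c a)) = c a := b.repr.apply_symm_apply _
  refine Set.infinite_of_injective_forall_mem (f := fun a => ρ.orbitOf (b.repr.symm (c a)))
    (fun a a' h => ?_) fun a => ⟨_, by rw [hinv, hce], rfl⟩
  obtain ⟨g, hg⟩ : b.repr.symm (c a) ∈ ρ.orbitOf (b.repr.symm (c a')) :=
    (Set.ext_iff.1 h _).1 ⟨1, by simp⟩
  have hprod := hb.prod_repr_zpow g (b.repr.symm (c a')) e
  refine Units.ext ?_
  rwa [show ρ g _ = _ from hg, hinv, hinv, hc, hc, he, MonoidHom.one_apply, Units.val_one,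
    one_mul] at hprod

end Eigenbases

section Characters

open Finsupp

variable {K : Type*} [Field K] {r : ℕ} {ι : Type*} {s : ι → Fin r → ℤ}

namespace Torus

theorem character_apply (a : Fin r → ℤ) (t : Torus K r) : character a t = ∏ j, t j ^ a j := rfl

theorem character_zero : character (K := K) (0 : Fin r → ℤ) = 1 := by
  ext t
  simp [character_apply]

theorem character_add (a c : Fin r → ℤ) :
    character (K := K) (a + c) = character a * character c := by
  ext t
  simp [character_apply, zpow_add, Finset.prod_mul_distrib]

theorem character_smul (z : ℤ) (a : Fin r → ℤ) :
    character (K := K) (z • a) = character a ^ z := by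
  ext t
  simp [character_apply, mul_comm z, zpow_mul, Finset.prod_zpow]

theorem character_linearCombination (s : ι → Fin r → ℤ) (e : ι →₀ ℤ) :
    character (K := K) (linearCombination ℤ s e) = e.prod fun i z => character (s i) ^ z := by
  induction e using Finsupp.induction_linear with
  | zero => rw [map_zero, character_zero, prod_zero_index]
  | add e f he hf =>
    rw [map_add, character_add, he, hf, prod_add_index'
      (fun i => zpow_zero (character (K := K) (s i))) fun i => zpow_add (character (K := K) (s i))]
  | single i z =>
    rw [linearCombination_single, character_smul]
    exact (prod_single_index (h := fun i z => character (K := K) (s i) ^ z)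
      (zpow_zero (character (K := K) (s i)))).symm

/-- Independent weights extend to a homomorphism `ℤ ^ r → Kˣ` with prescribed values on them,
because `Kˣ` is divisible, hence an injective abelian group; such a homomorphism is a point of the
torus. -/
theorem exists_character_eq [IsAlgClosed K] (hs : LinearIndependent ℤ s) (y : ι → Kˣ) :
    ∃ t : Torus K r, ∀ i, character (s i) t = y i := by
  let _ : DivisibleBy (Additive Kˣ) ℤ := divisibleByOfSMulRightSurj _ _
    fun hz y => (exists_units_zpow_eq hz y.toMul).imp fun _ h => congr_arg Additive.ofMul h
  obtain ⟨h, hh⟩ := (Module.Baer.of_divisible (Additive Kˣ)).extension_property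
    (linearCombination ℤ s) hs (linearCombination ℤ fun i => Additive.ofMul (y i))
  have hy (i : ι) : h (s i) = Additive.ofMul (y i) := by
    simpa using LinearMap.congr_fun hh (single i 1)
  refine ⟨fun j => (h (Pi.single j 1)).toMul, fun i => Additive.ofMul.injective ?_⟩
  rw [← hy, character_apply, ofMul_prod]
  conv_rhs => rw [pi_eq_sum_univ' (s i), map_sum]
  simp only [map_smul, ofMul_zpow, ofMul_toMul]

theorem character_eq_one_iff [IsAlgClosed K] {a : Fin r → ℤ} :
    character (K := K) a = 1 ↔ a = 0 := by
  refine ⟨fun h => by_contra fun ha => ?_, fun h => h ▸ character_zero⟩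
  have := IsAlgClosed.instInfinite (K := K)
  have := infinite_units_of_infinite K
  obtain ⟨u, hu⟩ := exists_ne (1 : Kˣ)
  obtain ⟨t, ht⟩ := exists_character_eq (s := fun _ : Unit => a)
    (linearIndependent_unique_iff.2 ha) fun _ => u
  exact hu (by rw [← ht (), h, MonoidHom.one_apply])

end Torus

theorem mapRange_intCast_mem_linearRelations_iff {e : ι →₀ ℤ} :
    e.mapRange (Int.cast : ℤ → ℚ) Int.cast_zero ∈
      linearRelations ℚ (fun i => rationalWeight (s i)) ↔ linearCombination ℤ s e = 0 := by
  have hcast : linearCombination ℚ (fun i => rationalWeight (s i))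
      (e.mapRange (Int.cast : ℤ → ℚ) Int.cast_zero) =
        rationalWeight (linearCombination ℤ s e) := by
    rw [linearCombination_apply, sum_mapRange_index fun i => zero_smul ℚ (rationalWeight (s i)),
      linearCombination_apply]
    ext j
    simp [Finsupp.sum, rationalWeight]
  rw [mem_linearRelations, hcast, funext_iff, funext_iff]
  exact forall_congr' fun j => Int.cast_eq_zero

theorem exists_mapRange_intCast_eq_smul (p : ι →₀ ℚ) :
    ∃ N : ℚ, 0 < N ∧ ∃ e : ι →₀ ℤ, e.mapRange (Int.cast : ℤ → ℚ) Int.cast_zero = N • p := by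
  let N : ℕ := ∏ i ∈ p.support, (p i).den
  refine ⟨N, Nat.cast_pos.2 (Finset.prod_pos fun i _ => (p i).den_pos),
    p.mapRange (fun q => ((N : ℚ) * q).num) (by simp), ?_⟩
  ext i
  obtain ⟨M, hM⟩ : (p i).den ∣ N := by
    by_cases hi : i ∈ p.support
    · exact Finset.dvd_prod_of_mem (fun i => (p i).den) hi
    · simp [notMem_support_iff.1 hi]
  have hint : (N : ℚ) * p i = ((M * (p i).num : ℤ) : ℚ) := by
    push_cast
    rw [hM, Nat.cast_mul, mul_right_comm, Rat.den_mul_eq_num, mul_comm]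
  rw [mapRange_apply, mapRange_apply, Finsupp.smul_apply, smul_eq_mul, hint, Rat.num_intCast]

theorem exists_relation_intCast_eq_smul {p : ι →₀ ℚ}
    (hp : p ∈ linearRelations ℚ fun i => rationalWeight (s i)) :
    ∃ N : ℚ, 0 < N ∧ ∃ e : ι →₀ ℤ, (∀ i, (e i : ℚ) = N * p i) ∧ e.support = p.support ∧
      linearCombination ℤ s e = 0 := by
  obtain ⟨N, hN, e, he⟩ := exists_mapRange_intCast_eq_smul p
  refine ⟨N, hN, e, fun i => DFunLike.congr_fun he i, ?_,
    mapRange_intCast_mem_linearRelations_iff.1 (he ▸ Submodule.smul_mem _ N hp)⟩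
  rw [← support_mapRange_of_injective Int.cast_zero e (Int.cast_injective (α := ℚ)), he,
    support_smul_eq hN.ne']

theorem linearIndepOn_of_forall_linearRelations {S : Set ι}
    (h : ∀ d ∈ linearRelations ℚ (fun i => rationalWeight (s i)), ↑d.support ⊆ S → d = 0) :
    LinearIndepOn ℤ s S := by
  rw [linearIndepOn_iff]
  intro e he hs
  refine mapRange_injective _ Int.cast_zero (Int.cast_injective (α := ℚ)) ?_
  rw [mapRange_zero]
  refine h _ (mapRange_intCast_mem_linearRelations_iff.2 hs) ?_
  exact (Finset.coe_subset.2 support_mapRange).trans ((mem_supported ℤ e).1 he)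

end Characters

section TorusRepresentations

open Finsupp Representation

variable {K V : Type*} [Field K] [AddCommGroup V] [Module K V] {r n : ℕ}
  {ρ : Representation K (Torus K r) V} {s : Fin n → Fin r → ℤ} {b : Module.Basis (Fin n) K V}

theorem IsWeightBasis.isEigenbasis (hb : IsWeightBasis ρ s b) :
    IsEigenbasis ρ (fun i => Torus.character (s i)) b := hb

variable [IsAlgClosed K]

theorem IsWeightBasis.isNilpotentVector_iff (hb : IsWeightBasis ρ s b) {x : V} :
    ρ.IsNilpotentVector x ↔ ∀ p ∈ linearRelations ℚ (fun i => rationalWeight (s i)), 0 ≤ p →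
      p.support ⊆ (b.repr x).support → p = 0 := by
  have hprod (m : Fin n →₀ ℕ) : (m.prod fun i k => Torus.character (K := K) (s i) ^ k) = 1 ↔
      linearCombination ℤ s (m.mapRange (Nat.cast : ℕ → ℤ) Nat.cast_zero) = 0 := by
    rw [← Torus.character_eq_one_iff (K := K), Torus.character_linearCombination,
      prod_mapRange_index fun i => zpow_zero (Torus.character (K := K) (s i))]
    simp only [zpow_natCast]
  rw [hb.isEigenbasis.isNilpotentVector_iff]
  constructor
  · intro h p hp hp0 hpx
    obtain ⟨N, hN, e, hep, hsupp, he⟩ := exists_relation_intCast_eq_smul hp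
    have he0 (i : Fin n) : 0 ≤ e i := by
      rw [← Int.cast_nonneg_iff (R := ℚ), hep]
      exact mul_nonneg hN.le (hp0 i)
    have hme : (e.mapRange Int.toNat rfl).mapRange (Nat.cast : ℕ → ℤ) Nat.cast_zero = e := by
      ext i
      simp [he0 i]
    have hm := h (e.mapRange Int.toNat rfl) (support_mapRange.trans (hsupp ▸ hpx))
      ((hprod _).2 (hme.symm ▸ he))
    rw [hm, mapRange_zero] at hme
    rw [← support_eq_empty, ← hsupp, ← hme, support_zero]
  · intro h m hmx hm
    have hp := h (m.mapRange (Nat.cast : ℕ → ℚ) Nat.cast_zero) ?_ (fun i => by simp)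
      (support_mapRange.trans hmx)
    · exact mapRange_injective _ Nat.cast_zero Nat.cast_injective (hp.trans mapRange_zero.symm)
    · convert mapRange_intCast_mem_linearRelations_iff.2 ((hprod m).1 hm) using 1
      ext i
      simp

theorem IsWeightBasis.orbitOf_eq (hb : IsWeightBasis ρ s b) {x : V}
    (hx : LinearIndepOn ℤ s ((b.repr x).support : Set (Fin n))) :
    ρ.orbitOf x = {y | (b.repr y).support = (b.repr x).support} := by
  refine Set.Subset.antisymm ?_ fun y hy => ?_
  · rintro _ ⟨t, rfl⟩
    exact hb.isEigenbasis.support_repr_apply t x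
  have hne (i : (b.repr x).support) : b.repr x i ≠ 0 := mem_support_iff.1 i.2
  have hney (i : (b.repr x).support) : b.repr y i ≠ 0 := mem_support_iff.1 (hy.symm ▸ i.2)
  obtain ⟨t, ht⟩ := Torus.exists_character_eq hx fun i =>
    Units.mk0 (b.repr y i / b.repr x i) (div_ne_zero (hney i) (hne i))
  refine ⟨t, b.repr.injective (Finsupp.ext fun i => ?_)⟩
  rw [hb.isEigenbasis.repr_apply]
  by_cases hi : i ∈ (b.repr x).support
  · rw [ht ⟨i, hi⟩, Units.val_mk0, div_mul_cancel₀ _ (hne ⟨i, hi⟩)]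
  · rw [notMem_support_iff.1 hi, notMem_support_iff.1 (hy.symm ▸ hi), mul_zero]

theorem IsWeightBasis.isVisible_iff (hb : IsWeightBasis ρ s b) :
    ρ.IsVisible ↔ HasPositiveVectors (linearRelations ℚ fun i => rationalWeight (s i)) := by
  constructor
  · intro hvis d hd hd0
    by_contra! hpos
    obtain ⟨-, -, e, -, hed, he⟩ := exists_relation_intCast_eq_smul hd
    have he0 : e ≠ 0 := by rwa [← support_nonempty_iff, hed, support_nonempty_iff]
    refine hb.isEigenbasis.infinite_orbits he0 ?_ (hvis.subset ?_)
    · rw [← Torus.character_linearCombination, he, Torus.character_zero]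
    · rintro _ ⟨x, hx, rfl⟩
      refine ⟨x, hb.isNilpotentVector_iff.2 fun p hp hp0 hpx => ?_, rfl⟩
      by_contra hne
      exact hpos p hp (hp0.lt_of_ne' hne) (hpx.trans (hx.trans hed).subset)
  · intro hpos
    refine (Set.finite_range fun U : Finset (Fin n) => {y | (b.repr y).support = U}).subset ?_
    rintro _ ⟨x, hx, rfl⟩
    refine ⟨(b.repr x).support, (hb.orbitOf_eq (linearIndepOn_of_forall_linearRelations ?_)).symm⟩
    intro d hd hdx
    by_contra hd0
    obtain ⟨p, hp, hp0, hpd⟩ := hpos d hd hd0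
    exact hp0.ne' (hb.isNilpotentVector_iff.1 hx p hp hp0.le (hpd.trans (mod_cast hdx)))

end TorusRepresentations

theorem mainTheorem6_general {K : Type*} [Field K] [IsAlgClosed K]
    {V : Type*} [AddCommGroup V] [Module K V] {r n : ℕ}
    (ρ : Representation K (Torus K r) V) (s : Fin n → Fin r → ℤ)
    (b : Module.Basis (Fin n) K V) (hb : IsWeightBasis ρ s b) :
    ρ.IsVisible ↔
      ∃ (l : ℕ) (I : Fin (l + 1) → Finset (Fin n)),
        (Pairwise fun j k => Disjoint (I j) (I k)) ∧
        (Finset.univ.biUnion I = Finset.univ) ∧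
        (iSupIndep (fun j => Submodule.span ℚ (weightSet s (I j))) ∧
          Submodule.span ℚ (weightSet s Finset.univ) =
            ⨆ j, Submodule.span ℚ (weightSet s (I j))) ∧
        (Module.finrank ℚ (Submodule.span ℚ (weightSet s (I 0))) = (I 0).card ∧
          ∀ j, j ≠ 0 →
            Module.finrank ℚ (Submodule.span ℚ (weightSet s (I j))) + 1 = (I j).card) ∧
        (∀ j, j ≠ 0 → (0 : Fin r → ℚ) ∈ convexHullInterior (weightSet s (I j))) := by
  rw [hb.isVisible_iff, hasPositiveVectors_iff_exists_partition]
  exact exists_congr fun l => exists_congr fun I => isPositiveCircuitPartition_linearRelations_iff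

theorem mainTheorem6 {K : Type*} [Field K] [IsAlgClosed K] [CharZero K]
    {V : Type*} [AddCommGroup V] [Module K V] {r n : ℕ}
    (ρ : Representation K (Torus K r) V) (s : Fin n → Fin r → ℤ)
    (b : Module.Basis (Fin n) K V) (hb : IsWeightBasis ρ s b) :
    ρ.IsVisible ↔
      ∃ (l : ℕ) (I : Fin (l + 1) → Finset (Fin n)),
        (Pairwise fun j k => Disjoint (I j) (I k)) ∧
        (Finset.univ.biUnion I = Finset.univ) ∧
        (iSupIndep (fun j => Submodule.span ℚ (weightSet s (I j))) ∧
          Submodule.span ℚ (weightSet s Finset.univ) =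
            ⨆ j, Submodule.span ℚ (weightSet s (I j))) ∧
        (Module.finrank ℚ (Submodule.span ℚ (weightSet s (I 0))) = (I 0).card ∧
          ∀ j, j ≠ 0 →
            Module.finrank ℚ (Submodule.span ℚ (weightSet s (I j))) + 1 = (I j).card) ∧
        (∀ j, j ≠ 0 → (0 : Fin r → ℚ) ∈ convexHullInterior (weightSet s (I j))) :=
  mainTheorem6_general ρ s b hb
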